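/- Let $h$ be the morphism on words over $\{0,1\}$ given by $h(1)=110$ and $h(0)=11$, and let $\mathbf k = 1101101111\cdots$ be the infinite word having every $h^n(1)$, $n\ge 0$, as a prefix (the fixed point of $h$). Let $\rho(n)$ denote the subword complexity of $\mathbf k$, that is, the number of distinct factors (blocks of consecutive letters) of length $n$ of $\mathbf k$. Then $$\limsup_{n\to\infty} \frac{\rho(n)}{n} = \frac{30+\sqrt3}{23} \qquad\text{and}\qquad \liminf_{n\to\infty} \frac{\rho(n)}{n} = \frac{3+\sqrt3}{4}.$$ -/

import Mathlib

open Filter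

/-- The images of single letters under the morphism `h` over the alphabet `{0, 1}`:
`h(1) = 110` and `h(0) = 11`. -/
def hLetter (a : Fin 2) : List (Fin 2) :=
  if a = 1 then [1, 1, 0] else [1, 1]

/-- The morphism `h` on finite words: concatenate the images of the letters. -/
def hMorphism (w : List (Fin 2)) : List (Fin 2) :=
  w.flatMap hLetter

/-- `K_n = h^n(1)`, so `K_0 = 1`, `K_1 = 110`, `K_2 = 11011011`, and so on. -/
def kimberlingPrefix (n : ℕ) : List (Fin 2) :=
  hMorphism^[n] [1]

theorem hMorphism_prefix {u v : List (Fin 2)} (huv : u <+: v) :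
    hMorphism u <+: hMorphism v := by
  obtain ⟨t, rfl⟩ := huv
  exact ⟨hMorphism t, by simp [hMorphism]⟩

theorem kimberlingPrefix_succ (n : ℕ) :
    kimberlingPrefix (n + 1) = hMorphism (kimberlingPrefix n) := by
  simp only [kimberlingPrefix, Function.iterate_succ_apply']

theorem kimberlingPrefix_prefix_succ (n : ℕ) :
    kimberlingPrefix n <+: kimberlingPrefix (n + 1) := by
  induction n with
  | zero => exact ⟨[1, 0], by simp [kimberlingPrefix, hMorphism, hLetter]⟩
  | succ n ih =>
    rw [kimberlingPrefix_succ n, kimberlingPrefix_succ (n + 1)]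
    exact hMorphism_prefix ih

theorem kimberlingPrefix_prefix {m n : ℕ} (hmn : m ≤ n) :
    kimberlingPrefix m <+: kimberlingPrefix n := by
  induction n, hmn using Nat.le_induction with
  | base => exact List.prefix_rfl
  | succ n _ ih => exact ih.trans (kimberlingPrefix_prefix_succ n)

theorem two_mul_length_le_length_hMorphism (w : List (Fin 2)) :
    2 * w.length ≤ (hMorphism w).length := by
  induction w with
  | nil => simp
  | cons a w ih =>
    have ha : 2 ≤ (hLetter a).length := by
      unfold hLetter
      split <;> simp
    simp only [hMorphism, List.flatMap_cons, List.length_append, List.length_cons] at ih ⊢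
    omega

theorem lt_length_kimberlingPrefix (n : ℕ) : n < (kimberlingPrefix n).length := by
  induction n with
  | zero => simp [kimberlingPrefix]
  | succ n ih =>
    have h2 := two_mul_length_le_length_hMorphism (kimberlingPrefix n)
    rw [kimberlingPrefix_succ]
    omega

/-- The infinite word `𝐤 = 1101101111⋯`, the limit of the words `K_n`. It is indexed from `0`,
so `kimberlingWord i` is the `(i + 1)`-st letter of `𝐤`. -/
def kimberlingWord (i : ℕ) : Fin 2 :=
  (kimberlingPrefix i)[i]'(lt_length_kimberlingPrefix i)

/-- Every `K_n` is a prefix of `𝐤`. -/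
theorem kimberlingPrefix_getElem (n i : ℕ) (hi : i < (kimberlingPrefix n).length) :
    (kimberlingPrefix n)[i] = kimberlingWord i := by
  unfold kimberlingWord
  rcases le_total n i with h | h
  · exact (kimberlingPrefix_prefix h).getElem hi
  · exact ((kimberlingPrefix_prefix h).getElem (lt_length_kimberlingPrefix i)).symm

/-- The set of factors of length `n` of an infinite word `x`, i.e. of the finite words
`x i, x (i + 1), …, x (i + n - 1)`. -/
def factorsOfLength {α : Type*} (x : ℕ → α) (n : ℕ) : Set (List α) :=
  {w | ∃ i : ℕ, w = (List.range n).map fun j => x (i + j)}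

/-- The subword complexity of an infinite word over a finite alphabet: the number of distinct
factors of length `n`. -/
noncomputable def subwordComplexity {α : Type*} [Finite α] (x : ℕ → α) (n : ℕ) : ℕ :=
  (factorsOfLength x n).ncard

/-- Over a finite alphabet there are only finitely many factors of each length, so that the
cardinality above is the true one. -/
theorem factorsOfLength_finite {α : Type*} [Finite α] (x : ℕ → α) (n : ℕ) :
    (factorsOfLength x n).Finite := by
  refine (List.finite_length_eq α n).subset ?_
  rintro w ⟨i, rfl⟩
  simp

namespace Kimberling

/-! The difference ρ(n+1) − ρ(n) counts the left special words of length n. Write Φ(v) = h(v)11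
(`extendedImage`). Φ preserves left special words, and a left special word containing 0 is a prefix
of Φ(v) for a shorter left special v; one without 0 is a prefix of 111, because 11111 is not a
factor. Hence (`isLeftSpecial_iff`) the left special words are the prefixes of k and those of the
words M_j = Φ^j(111), and M_j departs from k right after B_j = Φ^j(11).

Put g_j = |M_j| − |B_j|. Then g_{j+2} = 2g_{j+1} + 2g_j and |B_j| < |M_j| < |B_{j+1}|, so ρ has
slope 2 from |B_j|+1 to |M_j|+1 and slope 1 from there to |B_{j+1}|+1. Both limits lie between 1 and
2, so the extreme ratios occur, asymptotically, at these breakpoints. There ρ is g_{j+1} + g_j and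
g_{j+1} + 3g_j respectively, while 3|B_j| + 4 = 4g_j + 2g_{j+1}; the growth rate 1 + √3 of g_j gives
the two constants. -/

@[simp] theorem hMorphism_nil : hMorphism [] = [] := rfl

@[simp] theorem hMorphism_zero_cons (w : List (Fin 2)) :
    hMorphism (0 :: w) = 1 :: 1 :: hMorphism w := rfl

@[simp] theorem hMorphism_one_cons (w : List (Fin 2)) :
    hMorphism (1 :: w) = 1 :: 1 :: 0 :: hMorphism w := rfl

@[simp] theorem hMorphism_append (u v : List (Fin 2)) :
    hMorphism (u ++ v) = hMorphism u ++ hMorphism v := by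
  simp [hMorphism]

theorem eq_zero_or_eq_one (a : Fin 2) : a = 0 ∨ a = 1 := by
  fin_cases a <;> simp

theorem prefix_hMorphism_singleton (a : Fin 2) : [1, 1] <+: hMorphism [a] := by
  rcases eq_zero_or_eq_one a with rfl | rfl
  · exact ⟨[], rfl⟩
  · exact ⟨[0], rfl⟩

/-- The word `h(v) 11`, which is a prefix of `h(v a)` for every letter `a`. -/
def extendedImage (v : List (Fin 2)) : List (Fin 2) :=
  hMorphism v ++ [1, 1]

theorem extendedImage_prefix_hMorphism (v : List (Fin 2)) (a : Fin 2) :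
    extendedImage v <+: hMorphism (v ++ [a]) := by
  rw [hMorphism_append]
  exact (List.prefix_append_right_inj _).2 (prefix_hMorphism_singleton a)

theorem extendedImage_mono {u v : List (Fin 2)} (h : u <+: v) :
    extendedImage u <+: extendedImage v := by
  obtain ⟨t, rfl⟩ := h
  cases t with
  | nil => simp
  | cons a t =>
    refine (extendedImage_prefix_hMorphism u a).trans ⟨hMorphism t ++ [1, 1], ?_⟩
    rw [extendedImage, ← List.append_assoc, ← hMorphism_append]
    simp

/-! ### Factors, prefixes and left special words -/

/-- Finite factors of the infinite word. -/
def IsFactor (u : List (Fin 2)) : Prop :=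
  ∃ n, u <:+: kimberlingPrefix n

/-- Finite prefixes of the infinite word. -/
def IsPrefix (u : List (Fin 2)) : Prop :=
  ∃ n, u <+: kimberlingPrefix n

/-- Words that can be extended to the left by both letters. -/
def IsLeftSpecial (u : List (Fin 2)) : Prop :=
  IsFactor (0 :: u) ∧ IsFactor (1 :: u)

theorem IsFactor.infix {u v : List (Fin 2)} (hv : IsFactor v) (h : u <:+: v) : IsFactor u :=
  hv.imp fun _ hn => h.trans hn

theorem IsPrefix.prefix {u v : List (Fin 2)} (hv : IsPrefix v) (h : u <+: v) : IsPrefix u :=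
  hv.imp fun _ hn => h.trans hn

theorem IsLeftSpecial.prefix {u v : List (Fin 2)} (hv : IsLeftSpecial v) (h : u <+: v) :
    IsLeftSpecial u :=
  ⟨hv.1.infix ((List.prefix_cons_inj _).2 h).isInfix,
    hv.2.infix ((List.prefix_cons_inj _).2 h).isInfix⟩

theorem IsFactor.hMorphism {u : List (Fin 2)} (hu : IsFactor u) : IsFactor (hMorphism u) := by
  obtain ⟨n, p, q, h⟩ := hu
  refine ⟨n + 1, _root_.hMorphism p, _root_.hMorphism q, ?_⟩
  rw [kimberlingPrefix_succ, ← h]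
  simp

theorem kimberlingPrefix_succ_eq (n : ℕ) :
    ∃ a t, kimberlingPrefix (n + 1) = kimberlingPrefix n ++ a :: t := by
  obtain ⟨t, ht⟩ := kimberlingPrefix_prefix_succ n
  cases t with
  | nil =>
    have h1 := two_mul_length_le_length_hMorphism (kimberlingPrefix n)
    have h2 := lt_length_kimberlingPrefix n
    rw [← kimberlingPrefix_succ, ← ht] at h1
    simp at h1
    omega
  | cons a t => exact ⟨a, t, ht.symm⟩

theorem IsFactor.exists_append {u : List (Fin 2)} (hu : IsFactor u) :
    ∃ a, IsFactor (u ++ [a]) := by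
  obtain ⟨n, p, q, h⟩ := hu
  obtain ⟨a, t, ht⟩ := kimberlingPrefix_succ_eq n
  rw [← h] at ht
  cases q with
  | nil => exact ⟨a, n + 1, p, t, by simp [ht]⟩
  | cons b q => exact ⟨b, n + 1, p, q ++ a :: t, by simp [ht]⟩

theorem IsPrefix.exists_append {u : List (Fin 2)} (hu : IsPrefix u) :
    ∃ a, IsPrefix (u ++ [a]) := by
  obtain ⟨n, q, h⟩ := hu
  obtain ⟨a, t, ht⟩ := kimberlingPrefix_succ_eq n
  rw [← h] at ht
  cases q with
  | nil => exact ⟨a, n + 1, t, by simp [ht]⟩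
  | cons b q => exact ⟨b, n + 1, q ++ a :: t, by simp [ht]⟩

theorem IsPrefix.extendedImage {u : List (Fin 2)} (hu : IsPrefix u) :
    IsPrefix (extendedImage u) := by
  obtain ⟨a, n, h⟩ := hu.exists_append
  refine ⟨n + 1, (extendedImage_prefix_hMorphism u a).trans ?_⟩
  rw [kimberlingPrefix_succ]
  exact hMorphism_prefix h

/-- h(0) and h(1) end in different letters, so the two left extensions of u yield two of Φ(u), with
the letters swapped. The final 11 comes for free: every letter that can follow u has an image
starting with 11. -/
theorem IsLeftSpecial.extendedImage {u : List (Fin 2)} (hu : IsLeftSpecial u) :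
    IsLeftSpecial (extendedImage u) := by
  obtain ⟨⟨a, ha⟩, ⟨b, hb⟩⟩ := And.intro hu.1.exists_append hu.2.exists_append
  constructor
  · refine hb.hMorphism.infix (.trans ?_ ((List.suffix_append [1, 1] _).isInfix))
    exact ((List.prefix_cons_inj 0).2 (extendedImage_prefix_hMorphism u b)).isInfix
  · refine ha.hMorphism.infix (.trans ?_ ((List.suffix_append [1] _).isInfix))
    exact ((List.prefix_cons_inj 1).2 (extendedImage_prefix_hMorphism u a)).isInfix

theorem IsPrefix.eq_of_length_eq {u v : List (Fin 2)} (hu : IsPrefix u) (hv : IsPrefix v)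
    (h : u.length = v.length) : u = v := by
  obtain ⟨⟨m, hm⟩, ⟨n, hn⟩⟩ := And.intro hu hv
  exact (List.prefix_of_prefix_length_le (hm.trans (kimberlingPrefix_prefix (le_max_left m n)))
    (hn.trans (kimberlingPrefix_prefix (le_max_right m n))) h.le).eq_of_length h

/-! ### Desubstitution -/

/-- Every letter `0` in an image of `h` ends the image of a letter `1`. -/
theorem exists_of_hMorphism_eq_append_zero_cons {w p x : List (Fin 2)}
    (h : hMorphism w = p ++ 0 :: x) :
    ∃ w₁ w₂, w = w₁ ++ 1 :: w₂ ∧ hMorphism w₁ ++ [1, 1] = p ∧ hMorphism w₂ = x := by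
  induction w generalizing p with
  | nil => simp at h
  | cons a w ih =>
    rcases eq_zero_or_eq_one a with rfl | rfl
    · match p, h with
      | [], h => simp at h
      | [_], h => simp at h
      | b :: c :: p, h =>
        simp only [hMorphism_zero_cons, List.cons_append, List.cons.injEq] at h
        obtain ⟨rfl, rfl, h⟩ := h
        obtain ⟨w₁, w₂, rfl, rfl, rfl⟩ := ih h
        exact ⟨0 :: w₁, w₂, rfl, rfl, rfl⟩
    · match p, h with
      | [], h => simp at h
      | [_], h => simp at h
      | [b, c], h =>
        simp only [hMorphism_one_cons, List.cons_append, List.cons.injEq, List.nil_append] at h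
        obtain ⟨rfl, rfl, -, h⟩ := h
        exact ⟨[], w, rfl, rfl, h⟩
      | b :: c :: d :: p, h =>
        simp only [hMorphism_one_cons, List.cons_append, List.cons.injEq] at h
        obtain ⟨rfl, rfl, rfl, h⟩ := h
        obtain ⟨w₁, w₂, rfl, rfl, rfl⟩ := ih h
        exact ⟨1 :: w₁, w₂, rfl, rfl, rfl⟩

theorem hMorphism_ne_zero_cons (w x : List (Fin 2)) : hMorphism w ≠ 0 :: x := by
  cases w with
  | nil => simp
  | cons a w => rcases eq_zero_or_eq_one a with rfl | rfl <;> simp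

theorem not_isFactor_zero_zero : ¬ IsFactor [0, 0] := by
  rintro ⟨n, p, q, h⟩
  cases n with
  | zero =>
    have := congrArg List.length h
    simp [kimberlingPrefix] at this
    omega
  | succ n =>
    rw [kimberlingPrefix_succ, List.append_assoc] at h
    obtain ⟨-, w₂, -, -, h₂⟩ := exists_of_hMorphism_eq_append_zero_cons h.symm
    exact hMorphism_ne_zero_cons _ _ h₂

/-- h(1) ends in 0, so a run of 1s can only continue past the image of a 0. Five 1s overrun the
image in which they start and the next one. -/
theorem zero_zero_infix_of_replicate_infix_hMorphism {w : List (Fin 2)}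
    (h : [1, 1, 1, 1, 1] <:+: hMorphism w) : [0, 0] <:+: w := by
  induction w with
  | nil => simp at h
  | cons a w ih =>
    have key : [1, 1, 1] <+: hMorphism w → ∃ t, w = 0 :: t := by
      cases w with
      | nil => simp
      | cons b t => rcases eq_zero_or_eq_one b with rfl | rfl <;> simp
    rcases eq_zero_or_eq_one a with rfl | rfl
    · rw [hMorphism_zero_cons, List.infix_cons_iff, List.infix_cons_iff] at h
      rcases h with h | h | h
      · simp only [List.cons_prefix_cons, true_and] at h
        obtain ⟨t, rfl⟩ := key h
        exact ⟨[], t, rfl⟩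
      · simp only [List.cons_prefix_cons, true_and] at h
        obtain ⟨t, rfl⟩ := key (.trans ⟨[1], rfl⟩ h)
        exact ⟨[], t, rfl⟩
      · exact (ih h).trans (List.suffix_cons _ _).isInfix
    · rw [hMorphism_one_cons, List.infix_cons_iff, List.infix_cons_iff, List.infix_cons_iff] at h
      simp only [List.cons_prefix_cons, true_and, one_ne_zero, false_and, false_or] at h
      exact (ih h).trans (List.suffix_cons _ _).isInfix

theorem not_isFactor_ones : ¬ IsFactor [1, 1, 1, 1, 1] := by
  rintro ⟨n, h⟩
  cases n with
  | zero => simpa [kimberlingPrefix] using h.length_le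
  | succ n =>
    rw [kimberlingPrefix_succ] at h
    exact not_isFactor_zero_zero ⟨n, zero_zero_infix_of_replicate_infix_hMorphism h⟩

/-- Decoding from the left: after 11, the next letter tells 110 from 11 followed by another image.
Beyond the image of the common part, x can therefore reach at most 11 further. -/
theorem exists_common_prefix {x u v : List (Fin 2)} (hu : x <+: hMorphism u)
    (hv : x <+: hMorphism v) :
    ∃ w, w <+: u ∧ w <+: v ∧ x <+: extendedImage w ∧ w.length ≤ x.length := by
  have short : x <+: [1, 1] → ∃ w, w <+: u ∧ w <+: v ∧ x <+: extendedImage w ∧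
      w.length ≤ x.length := fun h => ⟨[], by simp, by simp, h, by simp⟩
  induction u generalizing x v with
  | nil => exact short (hu.trans (List.nil_prefix))
  | cons a u ih =>
    cases v with
    | nil => exact short (hv.trans (List.nil_prefix))
    | cons b v =>
      match x, hu, hv, short with
      | [], _, _, short => exact short (List.nil_prefix)
      | [c], hu, hv, short =>
        rcases eq_zero_or_eq_one a with rfl | rfl <;> simp at hu <;> subst hu <;>
          exact short ⟨[1], rfl⟩
      | [c, d], hu, hv, short =>
        rcases eq_zero_or_eq_one a with rfl | rfl <;> simp at hu <;>
          obtain ⟨rfl, rfl⟩ := hu <;> exact short ⟨[], rfl⟩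
      | c :: d :: e :: x, hu, hv, short =>
        rcases eq_zero_or_eq_one a with rfl | rfl <;> rcases eq_zero_or_eq_one b with rfl | rfl
        · simp only [hMorphism_zero_cons, List.cons_prefix_cons] at hu hv
          obtain ⟨rfl, rfl, hu⟩ := hu
          obtain ⟨w, h₁, h₂, h₃, h₄⟩ := ih hu hv.2.2
            (fun h => ⟨[], by simp, by simp, h, by simp⟩)
          refine ⟨0 :: w, by simpa, by simpa, by simpa [extendedImage] using h₃, ?_⟩
          simp at h₄ ⊢
          omega
        · simp only [hMorphism_zero_cons, hMorphism_one_cons, List.cons_prefix_cons] at hu hv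
          obtain ⟨-, -, t, ht⟩ := hu
          rw [hv.2.2.1] at ht
          exact absurd ht.symm (hMorphism_ne_zero_cons _ _)
        · simp only [hMorphism_zero_cons, hMorphism_one_cons, List.cons_prefix_cons] at hu hv
          obtain ⟨-, -, t, ht⟩ := hv
          rw [hu.2.2.1] at ht
          exact absurd ht.symm (hMorphism_ne_zero_cons _ _)
        · simp only [hMorphism_one_cons, List.cons_prefix_cons] at hu hv
          obtain ⟨rfl, rfl, rfl, hu⟩ := hu
          obtain ⟨w, h₁, h₂, h₃, h₄⟩ := ih hu hv.2.2.2
            (fun h => ⟨[], by simp, by simp, h, by simp⟩)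
          refine ⟨1 :: w, by simpa, by simpa, by simpa [extendedImage] using h₃, ?_⟩
          simp at h₄ ⊢
          omega

/-- If w began with 0, its next letter would be 1 since 00 is not a factor. As u contains 0, it
would begin with 1111, and 1u would contain 11111. -/
theorem exists_of_prefix_hMorphism {w u : List (Fin 2)} (hw : IsFactor (1 :: w))
    (hu : u <+: hMorphism w) (h0 : 0 ∈ u) (h1 : IsFactor (1 :: u)) :
    ∃ w' x, w = 1 :: w' ∧ u = 1 :: 1 :: 0 :: x ∧ x <+: hMorphism w' := by
  match w, hw, hu with
  | [], _, hu =>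
    rw [hMorphism_nil, List.prefix_nil] at hu
    simp [hu] at h0
  | [0], _, hu =>
    have := hu.subset h0
    simp at this
  | 0 :: 0 :: w, hw, _ =>
    exact absurd (hw.infix ⟨[1], w, rfl⟩) not_isFactor_zero_zero
  | 0 :: 1 :: w, _, hu =>
    match u, h0, h1, hu with
    | [_], h0, _, hu => simp [← List.mem_singleton.1 h0] at hu
    | [_, _], h0, _, hu => simp_all
    | [_, _, _], h0, _, hu => simp_all
    | a :: b :: c :: d :: u, _, h1, hu =>
      simp only [hMorphism_zero_cons, hMorphism_one_cons, List.cons_prefix_cons] at hu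
      obtain ⟨rfl, rfl, rfl, rfl, -⟩ := hu
      exact absurd (h1.infix ⟨[], u, rfl⟩) not_isFactor_ones
  | 1 :: w, _, hu =>
    match u, h0, hu with
    | [_], h0, hu => simp_all
    | [_, _], h0, hu => simp_all
    | a :: b :: c :: u, _, hu =>
      simp only [hMorphism_one_cons, List.cons_prefix_cons] at hu
      obtain ⟨rfl, rfl, rfl, hu⟩ := hu
      exact ⟨w, u, rfl, rfl, hu⟩

theorem eq_concat_zero_of_hMorphism_eq {w p : List (Fin 2)} (h : hMorphism w = p ++ [1]) :
    ∃ w', w = w' ++ [0] := by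
  rcases w.eq_nil_or_concat with rfl | ⟨w', a, rfl⟩
  · simp at h
  · rw [List.concat_eq_append] at h ⊢
    rcases eq_zero_or_eq_one a with rfl | rfl
    · exact ⟨w', rfl⟩
    · rw [hMorphism_append, show hMorphism [1] = [1, 1] ++ [0] from rfl,
        ← List.append_assoc] at h
      simpa using List.append_inj_right' h rfl

theorem IsFactor.exists_hMorphism_eq {u : List (Fin 2)} (hu : IsFactor u) :
    ∃ n p q, _root_.hMorphism (kimberlingPrefix n) = p ++ u ++ q := by
  obtain ⟨n, hn⟩ := hu
  obtain ⟨p, q, h⟩ := hn.trans (kimberlingPrefix_prefix_succ n).isInfix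
  exact ⟨n, p, q, by rw [← kimberlingPrefix_succ, h]⟩

/-- A left special word that contains the letter `0` comes from a shorter left special word. -/
theorem IsLeftSpecial.exists_prefix_extendedImage {u : List (Fin 2)} (hu : IsLeftSpecial u)
    (h0 : 0 ∈ u) :
    ∃ v, IsLeftSpecial v ∧ u <+: _root_.Kimberling.extendedImage v ∧ v.length < u.length := by
  obtain ⟨m, p, q, hm⟩ := hu.1.exists_hMorphism_eq
  rw [List.append_assoc, List.cons_append] at hm
  obtain ⟨w₁, w₂, hw, -, hq⟩ := exists_of_hMorphism_eq_append_zero_cons hm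
  have hf : IsFactor (1 :: w₂) := ⟨m, w₁, [], by simp [hw]⟩
  obtain ⟨w', x, rfl, rfl, hx⟩ := exists_of_prefix_hMorphism hf ⟨q, hq.symm⟩ h0 hu.2
  obtain ⟨n, p', q', hn⟩ := hu.2.exists_hMorphism_eq
  rw [show p' ++ 1 :: 1 :: 1 :: 0 :: x ++ q' = (p' ++ [1, 1, 1]) ++ 0 :: (x ++ q') by simp] at hn
  obtain ⟨z₁, z₂, hz, hp', hq'⟩ := exists_of_hMorphism_eq_append_zero_cons hn
  -- In 1u = 1110x the 0 closes a block 110, so the 1 before that block ends the image of a letter,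
  -- which must be 0.
  have hz₁ : hMorphism z₁ = p' ++ [1] := by
    rw [show p' ++ [1, 1, 1] = (p' ++ [1]) ++ [1, 1] by simp] at hp'
    exact List.append_inj_left' hp' rfl
  obtain ⟨z, rfl⟩ := eq_concat_zero_of_hMorphism_eq hz₁
  -- The two occurrences of x decode to words with a common prefix w; 1w is preceded by 1 in the
  -- first and by 0 in the second.
  obtain ⟨w, h₁, h₂, h₃, h₄⟩ := exists_common_prefix hx ⟨q', hq'.symm⟩
  refine ⟨1 :: w, ⟨?_, ?_⟩, by simpa [Kimberling.extendedImage] using h₃, by simp; omega⟩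
  · have : IsFactor (0 :: 1 :: z₂) := ⟨n, z, [], by simp [hz]⟩
    exact this.infix (List.IsPrefix.isInfix (by simpa))
  · exact hf.infix (List.IsPrefix.isInfix (by simpa))

/-! ### The tree of left special words -/

/-- The words at which the tree of left special words branches. -/
def branchWord (j : ℕ) : List (Fin 2) :=
  extendedImage^[j] [1, 1]

/-- The maximal left special words that are not prefixes of the infinite word. -/
def maximalWord (j : ℕ) : List (Fin 2) :=
  extendedImage^[j] [1, 1, 1]

theorem branchWord_succ (j : ℕ) : branchWord (j + 1) = extendedImage (branchWord j) := by
  simp only [branchWord, Function.iterate_succ_apply']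

theorem maximalWord_succ (j : ℕ) : maximalWord (j + 1) = extendedImage (maximalWord j) := by
  simp only [maximalWord, Function.iterate_succ_apply']

theorem isPrefix_branchWord (j : ℕ) : IsPrefix (branchWord j) := by
  induction j with
  | zero => exact ⟨1, [0], rfl⟩
  | succ j ih => rw [branchWord_succ]; exact ih.extendedImage

theorem isLeftSpecial_maximalWord (j : ℕ) : IsLeftSpecial (maximalWord j) := by
  induction j with
  | zero =>
    -- h³(1) = 1101101111⋯ contains 0111 and, one place later, 1111.
    exact ⟨⟨3, [1, 1, 0, 1, 1], [1, 0, 1, 1, 0, 1, 1, 1, 1, 0, 1, 1, 0], rfl⟩,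
      ⟨3, [1, 1, 0, 1, 1, 0], [0, 1, 1, 0, 1, 1, 1, 1, 0, 1, 1, 0], rfl⟩⟩
  | succ j ih => rw [maximalWord_succ]; exact ih.extendedImage

theorem branchWord_prefix_maximalWord (j : ℕ) : branchWord j <+: maximalWord j := by
  induction j with
  | zero => exact ⟨[1], rfl⟩
  | succ j ih => rw [branchWord_succ, maximalWord_succ]; exact extendedImage_mono ih

theorem isLeftSpecial_branchWord (j : ℕ) : IsLeftSpecial (branchWord j) :=
  (isLeftSpecial_maximalWord j).prefix (branchWord_prefix_maximalWord j)

theorem length_extendedImage (v : List (Fin 2)) :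
    (extendedImage v).length = 2 * v.length + v.count 1 + 2 := by
  rw [extendedImage, List.length_append]
  congr 1
  induction v with
  | nil => rfl
  | cons a v ih => rcases eq_zero_or_eq_one a with rfl | rfl <;> simp [ih] <;> ring

theorem count_one_extendedImage (v : List (Fin 2)) :
    (extendedImage v).count 1 = 2 * v.length + 2 := by
  rw [extendedImage, List.count_append]
  congr 1
  induction v with
  | nil => rfl
  | cons a v ih => rcases eq_zero_or_eq_one a with rfl | rfl <;> simp [ih] <;> ring

/-- Every image of a letter contains exactly two 1s, so the number of 1s in Φ(v) depends only on
|v|. This closes the length recurrence. -/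
theorem length_extendedImage_extendedImage (v : List (Fin 2)) :
    (extendedImage (extendedImage v)).length = 2 * (extendedImage v).length + 2 * v.length + 4 := by
  rw [length_extendedImage, count_one_extendedImage]
  ring

/-- The branch words are left special prefixes of k of unbounded length. -/
theorem IsPrefix.isLeftSpecial {u : List (Fin 2)} (hu : IsPrefix u) : IsLeftSpecial u := by
  have hlen : ∀ j, j ≤ (branchWord j).length := by
    intro j
    induction j with
    | zero => simp
    | succ j ih => rw [branchWord_succ, length_extendedImage]; omega
  have hj := hlen u.length
  have hp := (isPrefix_branchWord u.length).prefix (List.take_prefix u.length _)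
  rw [hu.eq_of_length_eq hp (by simpa using hj)]
  exact (isLeftSpecial_branchWord _).prefix (List.take_prefix _ _)

/-- Φ(s0) = Φ(s)11 and Φ(s1) = Φ(s)011: the letter after the branching point is flipped, so two
distinct continuations stay distinct under Φ. -/
theorem exists_letter_prefix_extendedImage (a : Fin 2) : ∃ b, b ≠ a ∧ ∀ s w : List (Fin 2),
    s ++ [a] <+: w → extendedImage s ++ [b] <+: extendedImage w := by
  rcases eq_zero_or_eq_one a with rfl | rfl
  · refine ⟨1, by simp, fun s w h => .trans ?_ (extendedImage_mono h)⟩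
    exact ⟨[1], by simp [extendedImage]⟩
  · refine ⟨0, by simp, fun s w h => .trans ?_ (extendedImage_mono h)⟩
    exact ⟨[1, 1], by simp [extendedImage]⟩

theorem exists_branch (j : ℕ) : ∃ a b, a ≠ b ∧ branchWord j ++ [a] <+: maximalWord j ∧
    IsPrefix (branchWord j ++ [b]) := by
  induction j with
  | zero => exact ⟨1, 0, by simp, ⟨[], rfl⟩, 1, ⟨[], rfl⟩⟩
  | succ j ih =>
    obtain ⟨a, b, hab, ha, hb⟩ := ih
    obtain ⟨a', ha', hpa⟩ := exists_letter_prefix_extendedImage a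
    obtain ⟨b', hb', hpb⟩ := exists_letter_prefix_extendedImage b
    refine ⟨a', b', by omega, ?_, ?_⟩
    · rw [branchWord_succ, maximalWord_succ]
      exact hpa _ _ ha
    · rw [branchWord_succ]
      exact hb.extendedImage.prefix (hpb _ _ List.prefix_rfl)

theorem not_isPrefix_of_length_lt {j : ℕ} {u : List (Fin 2)} (hu : u <+: maximalWord j)
    (h : (branchWord j).length < u.length) : ¬ IsPrefix u := by
  intro hp
  obtain ⟨a, b, hab, ha, hb⟩ := exists_branch j
  have := (hp.prefix (List.prefix_of_prefix_length_le ha hu (by simpa using h))).eq_of_length_eq hb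
    (by simp)
  simp [hab] at this

theorem isLeftSpecial_iff {u : List (Fin 2)} :
    IsLeftSpecial u ↔ IsPrefix u ∨ ∃ j, u <+: maximalWord j := by
  refine ⟨fun hu => ?_, ?_⟩
  · induction hl : u.length using Nat.strong_induction_on generalizing u with
    | _ l ih =>
      subst hl
      by_cases h0 : 0 ∈ u
      · obtain ⟨v, hv, huv, hlt⟩ := hu.exists_prefix_extendedImage h0
        rcases ih _ hlt hv rfl with h | ⟨j, h⟩
        · exact .inl (h.extendedImage.prefix huv)
        · refine .inr ⟨j + 1, huv.trans ?_⟩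
          rw [maximalWord_succ]
          exact extendedImage_mono h
      · right
        refine ⟨0, ?_⟩
        have hrep : u = List.replicate u.length 1 := List.eq_replicate_iff.2
          ⟨rfl, fun b hb => (eq_zero_or_eq_one b).resolve_left fun h => h0 (h ▸ hb)⟩
        -- Here u consists of 1s only and 1u is a factor, so four 1s in u would give 11111.
        have hle : u.length ≤ 3 := by
          by_contra! hlt
          obtain ⟨k, hk⟩ := Nat.exists_eq_add_of_lt hlt
          have h1 := hu.2
          rw [hrep, hk, show 3 + k + 1 = 4 + k by omega] at h1
          refine not_isFactor_ones (h1.infix ⟨[], List.replicate k 1, ?_⟩)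
          rw [List.replicate_add]
          rfl
        rw [hrep]
        exact ⟨List.replicate (3 - u.length) 1, by
          rw [← List.replicate_add, Nat.add_sub_cancel' hle]; rfl⟩
  · rintro (h | ⟨j, h⟩)
    · exact h.isLeftSpecial
    · exact (isLeftSpecial_maximalWord j).prefix h

/-! ### Complexity increments -/

theorem map_range_eq_take {m i n : ℕ} (h : i + n ≤ (kimberlingPrefix m).length) :
    ((List.range n).map fun j => kimberlingWord (i + j)) =
      ((kimberlingPrefix m).drop i).take n := by
  apply List.ext_getElem
  · simp; omega
  · intro j h₁ h₂
    simp at h₁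
    rw [List.getElem_map, List.getElem_range, List.getElem_take, List.getElem_drop,
      kimberlingPrefix_getElem]

theorem mem_factorsOfLength_iff {n : ℕ} {u : List (Fin 2)} :
    u ∈ factorsOfLength kimberlingWord n ↔ u.length = n ∧ IsFactor u := by
  constructor
  · rintro ⟨i, rfl⟩
    refine ⟨by simp, i + n, ?_⟩
    rw [map_range_eq_take (lt_length_kimberlingPrefix (i + n)).le]
    exact (List.take_prefix _ _).isInfix.trans (List.drop_suffix _ _).isInfix
  · rintro ⟨rfl, m, p, q, h⟩
    refine ⟨p.length, ?_⟩
    rw [map_range_eq_take (m := m), ← h]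
    · simp
    · rw [← h]; simp

theorem isPrefix_map_range (n : ℕ) : IsPrefix ((List.range n).map kimberlingWord) := by
  refine ⟨n, ?_⟩
  have := map_range_eq_take (m := n) (i := 0) (n := n) (by
    simpa using (lt_length_kimberlingPrefix n).le)
  simp only [zero_add, List.drop_zero] at this
  rw [this]
  exact List.take_prefix _ _

theorem IsFactor.exists_cons {u : List (Fin 2)} (hu : IsFactor u) :
    ∃ a, IsFactor (a :: u) := by
  obtain ⟨n, p, q, h⟩ := hu
  rcases p.eq_nil_or_concat with rfl | ⟨p, a, rfl⟩
  · exact ⟨0, (IsPrefix.isLeftSpecial ⟨n, q, h⟩).1⟩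
  · exact ⟨a, n, p, q, by simpa using h⟩

/-- The left special words of length `n`. -/
def leftSpecialWords (n : ℕ) : Set (List (Fin 2)) :=
  {u | u.length = n ∧ IsLeftSpecial u}

/-- Sort the factors of length n + 1 by first letter; the tails form sets A 0 and A 1. Their union
is all factors of length n, since each extends to the left, and their intersection is the left
special ones. -/
theorem subwordComplexity_succ (n : ℕ) : subwordComplexity kimberlingWord (n + 1) =
    subwordComplexity kimberlingWord n + (leftSpecialWords n).ncard := by
  let A (a : Fin 2) : Set (List (Fin 2)) := {u | u.length = n ∧ IsFactor (a :: u)}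
  have hfin (a : Fin 2) : (A a).Finite :=
    (List.finite_length_eq (Fin 2) n).subset fun u hu => hu.1
  have hsplit : factorsOfLength kimberlingWord (n + 1) =
      (List.cons 0 '' A 0) ∪ (List.cons 1 '' A 1) := by
    ext u
    rw [mem_factorsOfLength_iff]
    constructor
    · rintro ⟨hl, hu⟩
      cases u with
      | nil => simp at hl
      | cons a u =>
        have hl' : u.length = n := by simpa using hl
        rcases eq_zero_or_eq_one a with rfl | rfl
        · exact .inl ⟨u, ⟨hl', hu⟩, rfl⟩
        · exact .inr ⟨u, ⟨hl', hu⟩, rfl⟩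
    · rintro (⟨v, ⟨hl, hv⟩, rfl⟩ | ⟨v, ⟨hl, hv⟩, rfl⟩) <;> exact ⟨by simp [hl], hv⟩
  have hdisj : Disjoint (List.cons 0 '' A 0) (List.cons 1 '' A 1) := by
    rw [Set.disjoint_left]
    rintro _ ⟨u, -, rfl⟩ ⟨v, -, hv⟩
    simp at hv
  have hunion : factorsOfLength kimberlingWord n = A 0 ∪ A 1 := by
    ext u
    rw [mem_factorsOfLength_iff]
    constructor
    · rintro ⟨hl, hu⟩
      obtain ⟨a, ha⟩ := hu.exists_cons
      rcases eq_zero_or_eq_one a with rfl | rfl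
      · exact .inl ⟨hl, ha⟩
      · exact .inr ⟨hl, ha⟩
    · rintro (⟨hl, hu⟩ | ⟨hl, hu⟩) <;> exact ⟨hl, hu.infix (List.suffix_cons _ _).isInfix⟩
  have hinter : leftSpecialWords n = A 0 ∩ A 1 := by
    ext u
    exact ⟨fun h => ⟨⟨h.1, h.2.1⟩, h.1, h.2.2⟩, fun h => ⟨h.1.1, h.1.2, h.2.2⟩⟩
  rw [subwordComplexity, subwordComplexity, hsplit, hunion, hinter,
    Set.ncard_union_eq hdisj ((hfin 0).image _) ((hfin 1).image _),
    Set.ncard_image_of_injective _ List.cons_injective,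
    Set.ncard_image_of_injective _ List.cons_injective,
    Set.ncard_union_add_ncard_inter _ _ (hfin 0) (hfin 1)]

theorem subwordComplexity_zero : subwordComplexity kimberlingWord 0 = 1 := by
  have : factorsOfLength kimberlingWord 0 = {[]} := by
    ext u
    simp [factorsOfLength]
  rw [subwordComplexity, this, Set.ncard_singleton]

theorem isPrefix_iff {u : List (Fin 2)} :
    IsPrefix u ↔ u = (List.range u.length).map kimberlingWord :=
  ⟨fun h => h.eq_of_length_eq (isPrefix_map_range _) (by simp),
    fun h => h ▸ isPrefix_map_range _⟩

/-- M_j contributes a left special word that is not a prefix of k only at lengths in (|B_j|, |M_j|].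
-/
theorem ncard_leftSpecialWords_eq_one {n : ℕ}
    (h : ∀ j, n ≤ (branchWord j).length ∨ (maximalWord j).length < n) :
    (leftSpecialWords n).ncard = 1 := by
  rw [Set.ncard_eq_one]
  refine ⟨(List.range n).map kimberlingWord, Set.eq_singleton_iff_unique_mem.2
    ⟨⟨by simp, (isPrefix_map_range n).isLeftSpecial⟩, ?_⟩⟩
  rintro u ⟨rfl, hu⟩
  rw [← isPrefix_iff]
  rcases isLeftSpecial_iff.1 hu with hp | ⟨j, hj⟩
  · exact hp
  · rcases h j with h | h
    · exact (isPrefix_branchWord j).prefix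
        (List.prefix_of_prefix_length_le hj (branchWord_prefix_maximalWord j) h)
    · exact absurd hj.length_le (by omega)

/-! ### Lengths of the branch and maximal words -/

/-- The number of lengths at which there are two left special words coming from `branchWord j`. -/
def branchGap : ℕ → ℕ
  | 0 => 1
  | 1 => 3
  | n + 2 => 2 * branchGap (n + 1) + 2 * branchGap n

/-- The recurrence L'' = 2L' + 2L + 4 has fixed point −4/3, so 3|B_j| + 4 obeys the homogeneous
recurrence of `branchGap`, and so does the difference |M_j| − |B_j|. -/
theorem length_branchWord_and_maximalWord (j : ℕ) :
    3 * (branchWord j).length + 4 = 4 * branchGap j + 2 * branchGap (j + 1) ∧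
      (maximalWord j).length = (branchWord j).length + branchGap j := by
  induction j using Nat.twoStepInduction with
  | zero => exact ⟨rfl, rfl⟩
  | one => exact ⟨rfl, rfl⟩
  | more j h₁ h₂ =>
    rw [branchWord_succ, branchWord_succ, maximalWord_succ, maximalWord_succ,
      length_extendedImage_extendedImage, length_extendedImage_extendedImage,
      ← branchWord_succ, ← maximalWord_succ]
    simp only [branchGap] at *
    omega

theorem branchGap_lt_succ (j : ℕ) : branchGap j < branchGap (j + 1) := by
  induction j with
  | zero => simp [branchGap]
  | succ j ih => rw [branchGap]; omega

/-- This keeps the intervals (|B_j|, |M_j|] disjoint, so no length has more than two left special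
words. -/
theorem length_maximalWord_lt_length_branchWord_succ (j : ℕ) :
    (maximalWord j).length < (branchWord (j + 1)).length := by
  have h₁ := length_branchWord_and_maximalWord j
  have h₂ := (length_branchWord_and_maximalWord (j + 1)).1
  have h₃ := branchGap_lt_succ j
  simp only [branchGap] at *
  omega

theorem length_branchWord_lt_length_maximalWord (j : ℕ) :
    (branchWord j).length < (maximalWord j).length := by
  obtain ⟨a, _, _, h, _⟩ := exists_branch j
  simpa using h.length_le

theorem strictMono_length_branchWord : StrictMono fun j => (branchWord j).length :=
  strictMono_nat_of_lt_succ fun j => (length_branchWord_lt_length_maximalWord j).trans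
    (length_maximalWord_lt_length_branchWord_succ j)

theorem length_maximalWord_lt_length_branchWord {i j : ℕ} (h : i < j) :
    (maximalWord i).length < (branchWord j).length := by
  exact (length_maximalWord_lt_length_branchWord_succ i).trans_le
    (strictMono_length_branchWord.monotone h)

theorem ncard_leftSpecialWords_eq_two {n j : ℕ} (h₁ : (branchWord j).length < n)
    (h₂ : n ≤ (maximalWord j).length) : (leftSpecialWords n).ncard = 2 := by
  have hlen : ((maximalWord j).take n).length = n := by simpa using h₂
  have hnp : ¬ IsPrefix ((maximalWord j).take n) :=
    not_isPrefix_of_length_lt (List.take_prefix _ _) (by omega)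
  rw [Set.ncard_eq_two]
  refine ⟨(List.range n).map kimberlingWord, (maximalWord j).take n, ?_, ?_⟩
  · intro h
    exact hnp (h ▸ isPrefix_map_range n)
  · ext u
    rw [Set.mem_insert_iff, Set.mem_singleton_iff]
    constructor
    · rintro ⟨rfl, hu⟩
      rcases isLeftSpecial_iff.1 hu with hp | ⟨i, hi⟩
      · exact .inl (isPrefix_iff.1 hp)
      · rcases lt_trichotomy i j with hij | rfl | hij
        · have := hi.length_le
          have := length_maximalWord_lt_length_branchWord hij
          omega
        · exact .inr (List.prefix_iff_eq_take.1 hi)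
        · have := length_maximalWord_lt_length_branchWord hij
          exact .inl (isPrefix_iff.1 ((isPrefix_branchWord i).prefix
            (List.prefix_of_prefix_length_le hi (branchWord_prefix_maximalWord i) (by omega))))
    · rintro (rfl | rfl)
      · exact ⟨by simp, (isPrefix_map_range n).isLeftSpecial⟩
      · exact ⟨hlen, (isLeftSpecial_maximalWord j).prefix (List.take_prefix _ _)⟩

/-! ### Complexity at the breakpoints -/

theorem subwordComplexity_add_two_mul (j t : ℕ) (ht : t ≤ branchGap j) :
    subwordComplexity kimberlingWord ((branchWord j).length + 1 + t) =
      subwordComplexity kimberlingWord ((branchWord j).length + 1) + 2 * t := by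
  induction t with
  | zero => rfl
  | succ t ih =>
    have := (length_branchWord_and_maximalWord j).2
    rw [← add_assoc, subwordComplexity_succ, ih (by omega),
      ncard_leftSpecialWords_eq_two (j := j) (by omega) (by omega)]
    ring

theorem subwordComplexity_add (j t : ℕ)
    (ht : (maximalWord j).length + t ≤ (branchWord (j + 1)).length) :
    subwordComplexity kimberlingWord ((maximalWord j).length + 1 + t) =
      subwordComplexity kimberlingWord ((maximalWord j).length + 1) + t := by
  induction t with
  | zero => rfl
  | succ t ih =>
    rw [← add_assoc, subwordComplexity_succ, ih (by omega), ncard_leftSpecialWords_eq_one, add_assoc]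
    intro i
    rcases lt_or_ge j i with h | h
    · rcases (show j + 1 ≤ i from h).eq_or_lt with rfl | h
      · left; omega
      · have := length_maximalWord_lt_length_branchWord h
        have := length_branchWord_lt_length_maximalWord (j + 1)
        left; omega
    · rcases h.eq_or_lt with rfl | h
      · right; omega
      · have := length_maximalWord_lt_length_branchWord h
        have := length_branchWord_lt_length_maximalWord j
        right; omega

theorem subwordComplexity_three : subwordComplexity kimberlingWord 3 = 4 := by
  have h (n : ℕ) (hn : n ≤ 2) : (leftSpecialWords n).ncard = 1 := by
    refine ncard_leftSpecialWords_eq_one fun j => .inl (hn.trans ?_)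
    rcases j.eq_zero_or_pos with rfl | hj
    · rfl
    · have := length_maximalWord_lt_length_branchWord hj
      simp only [maximalWord, Function.iterate_zero, id, List.length_cons] at this
      omega
  rw [subwordComplexity_succ, subwordComplexity_succ, subwordComplexity_succ,
    subwordComplexity_zero, h 0 (by simp), h 1 (by simp), h 2 (by simp)]

theorem subwordComplexity_branch (j : ℕ) :
    subwordComplexity kimberlingWord ((branchWord j).length + 1) =
      branchGap (j + 1) + branchGap j := by
  induction j with
  | zero =>
    rw [show (branchWord 0).length + 1 = 3 from rfl, subwordComplexity_three]
    rfl
  | succ j ih =>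
    have h₁ := subwordComplexity_add_two_mul j _ le_rfl
    have h₂ := length_branchWord_and_maximalWord j
    have h₃ := length_branchWord_and_maximalWord (j + 1)
    have h₄ := length_maximalWord_lt_length_branchWord_succ j
    obtain ⟨t, ht⟩ := Nat.exists_eq_add_of_le h₄.le
    have h₅ := subwordComplexity_add j t ht.ge
    rw [show (maximalWord j).length + 1 + t = (branchWord (j + 1)).length + 1 by omega,
      show (maximalWord j).length + 1 = (branchWord j).length + 1 + branchGap j by omega] at h₅
    simp only [branchGap] at *
    omega

/-! ### Asymptotic constants -/

/-- The roots of x² = 2x + 2 are 1 ± √3; subtracting the dominant part leaves an error multiplied at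
each step by 1 − √3, of absolute value at most 1. -/
theorem abs_branchGap_succ_sub_le (j : ℕ) :
    |(branchGap (j + 1) : ℝ) - (1 + √3) * branchGap j| ≤ 1 := by
  have h3 : √3 ^ 2 = 3 := Real.sq_sqrt (by norm_num)
  have hlo : 1 ≤ √3 := Real.one_le_sqrt.2 (by norm_num)
  have hhi : √3 ≤ 2 := Real.sqrt_le_iff.2 (by norm_num)
  induction j with
  | zero =>
    simp only [branchGap]
    rw [abs_le]
    constructor <;> push_cast <;> linarith
  | succ j ih =>
    have h : (branchGap (j + 1 + 1) : ℝ) - (1 + √3) * branchGap (j + 1) =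
        (1 - √3) * (branchGap (j + 1) - (1 + √3) * branchGap j) := by
      rw [branchGap]
      push_cast
      linear_combination (-(branchGap j : ℝ)) * h3
    rw [h, abs_mul]
    refine mul_le_one₀ ?_ (abs_nonneg _) ih
    rw [abs_le]
    constructor <;> linarith

theorem exists_length_branchWord_le {n : ℕ} (hn : 3 ≤ n) :
    ∃ j, (branchWord j).length + 1 ≤ n ∧ n ≤ (branchWord (j + 1)).length + 1 := by
  have hex : ∃ j, n ≤ (branchWord (j + 1)).length + 1 :=
    ⟨n, (strictMono_length_branchWord.le_apply (x := n)).trans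
      ((strictMono_length_branchWord n.lt_succ_self).le.trans (Nat.le_succ _))⟩
  classical
  refine ⟨Nat.find hex, ?_, Nat.find_spec hex⟩
  rcases h : Nat.find hex with - | j
  · exact hn
  · have := Nat.find_min hex (m := j) (by omega)
    omega

theorem tendsto_length_branchWord : Tendsto (fun j => (branchWord j).length + 1) atTop atTop :=
  tendsto_atTop_mono (fun _ => Nat.le_succ _) strictMono_length_branchWord.tendsto_atTop

theorem tendsto_length_maximalWord : Tendsto (fun j => (maximalWord j).length + 1) atTop atTop :=
  tendsto_atTop_mono (fun j => by simpa using (length_branchWord_lt_length_maximalWord j).le)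
    tendsto_length_branchWord

theorem subwordComplexity_maximal (j : ℕ) :
    subwordComplexity kimberlingWord ((maximalWord j).length + 1) =
      branchGap (j + 1) + 3 * branchGap j := by
  have h := subwordComplexity_add_two_mul j _ le_rfl
  rw [subwordComplexity_branch,
    show (branchWord j).length + 1 + branchGap j = (maximalWord j).length + 1 by
      have := (length_branchWord_and_maximalWord j).2
      omega] at h
  omega

theorem abs_subwordComplexity_branch_sub_le (j : ℕ) :
    |(subwordComplexity kimberlingWord ((branchWord j).length + 1) : ℝ) -
      (3 + √3) / 4 * (((branchWord j).length + 1 : ℕ) : ℝ)| ≤ 5 := by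
  have h3 : √3 ^ 2 = 3 := Real.sq_sqrt (by norm_num)
  have hlo : 1 ≤ √3 := Real.one_le_sqrt.2 (by norm_num)
  have hhi : √3 ≤ 2 := Real.sqrt_le_iff.2 (by norm_num)
  have ha : 3 * ((branchWord j).length : ℝ) + 4 = 4 * branchGap j + 2 * branchGap (j + 1) := by
    exact_mod_cast (length_branchWord_and_maximalWord j).1
  have he := abs_branchGap_succ_sub_le j
  rw [subwordComplexity_branch]
  -- The slope (3 + √3)/4 is the one for which only the bounded error of `abs_branchGap_succ_sub_le`
  -- and a constant remain.
  have key : ((branchGap (j + 1) + branchGap j : ℕ) : ℝ) -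
      (3 + √3) / 4 * (((branchWord j).length + 1 : ℕ) : ℝ) =
      (3 - √3) / 6 * (branchGap (j + 1) - (1 + √3) * branchGap j) + (3 + √3) / 12 := by
    push_cast
    linear_combination (-(3 + √3) / 12) * ha - ((branchGap j : ℝ) / 6) * h3
  rw [key]
  rw [abs_le] at he ⊢
  constructor <;> nlinarith

theorem abs_subwordComplexity_maximal_sub_le (j : ℕ) :
    |(subwordComplexity kimberlingWord ((maximalWord j).length + 1) : ℝ) -
      (30 + √3) / 23 * (((maximalWord j).length + 1 : ℕ) : ℝ)| ≤ 5 := by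
  have h3 : √3 ^ 2 = 3 := Real.sq_sqrt (by norm_num)
  have hlo : 1 ≤ √3 := Real.one_le_sqrt.2 (by norm_num)
  have hhi : √3 ≤ 2 := Real.sqrt_le_iff.2 (by norm_num)
  have ha : 3 * ((branchWord j).length : ℝ) + 4 = 4 * branchGap j + 2 * branchGap (j + 1) := by
    exact_mod_cast (length_branchWord_and_maximalWord j).1
  have he := abs_branchGap_succ_sub_le j
  rw [subwordComplexity_maximal, (length_branchWord_and_maximalWord j).2]
  have key : ((branchGap (j + 1) + 3 * branchGap j : ℕ) : ℝ) -
      (30 + √3) / 23 * (((branchWord j).length + branchGap j + 1 : ℕ) : ℝ) =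
      (9 - 2 * √3) / 69 * (branchGap (j + 1) - (1 + √3) * branchGap j) + (30 + √3) / 69 := by
    push_cast
    linear_combination (-(30 + √3) / 69) * ha - (2 * (branchGap j : ℝ) / 69) * h3
  rw [key]
  rw [abs_le] at he ⊢
  constructor <;> nlinarith

/-- Both constants lie between the slopes 1 and 2. So ρ(n) minus a constant times n rises on the
slope-2 pieces and falls on the slope-1 pieces: the lower bound carries over from the adjacent
valley, the upper bound from the adjacent peak. -/
theorem subwordComplexity_bounds {n : ℕ} (hn : 3 ≤ n) :
    (3 + √3) / 4 * n - 5 ≤ (subwordComplexity kimberlingWord n : ℝ) ∧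
      (subwordComplexity kimberlingWord n : ℝ) ≤ (30 + √3) / 23 * n + 5 := by
  have hlo : 1 ≤ √3 := Real.one_le_sqrt.2 (by norm_num)
  have hhi : √3 ≤ 2 := Real.sqrt_le_iff.2 (by norm_num)
  obtain ⟨j, h₁, h₂⟩ := exists_length_branchWord_le hn
  have hlen := (length_branchWord_and_maximalWord j).2
  have hpeak := abs_subwordComplexity_maximal_sub_le j
  rw [abs_le] at hpeak
  rcases le_total n ((maximalWord j).length + 1) with h | h
  · have hvalley := abs_subwordComplexity_branch_sub_le j
    rw [abs_le] at hvalley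
    obtain ⟨t, ht⟩ := Nat.exists_eq_add_of_le h₁
    obtain ⟨u, hu⟩ := Nat.exists_eq_add_of_le h
    have hρ₁ := subwordComplexity_add_two_mul j t (by omega)
    have hρ₂ := subwordComplexity_add_two_mul j _ le_rfl
    rw [← ht] at hρ₁
    rw [show (branchWord j).length + 1 + branchGap j = (maximalWord j).length + 1 by omega,
      show branchGap j = t + u by omega] at hρ₂
    have hρ₃ : (subwordComplexity kimberlingWord ((maximalWord j).length + 1) : ℝ) =
        subwordComplexity kimberlingWord n + 2 * u := by
      exact_mod_cast (by omega)
    have hρ₁' : (subwordComplexity kimberlingWord n : ℝ) =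
        subwordComplexity kimberlingWord ((branchWord j).length + 1) + 2 * t := by
      exact_mod_cast hρ₁
    have ht' : (n : ℝ) = ((branchWord j).length + 1 : ℕ) + t := by exact_mod_cast ht
    have hu' : (((maximalWord j).length + 1 : ℕ) : ℝ) = n + u := by exact_mod_cast hu
    have ht₀ : (0 : ℝ) ≤ t := t.cast_nonneg
    have hu₀ : (0 : ℝ) ≤ u := u.cast_nonneg
    constructor
    · rw [ht', hρ₁']
      nlinarith
    · rw [hu', hρ₃] at hpeak
      nlinarith
  · have hvalley := abs_subwordComplexity_branch_sub_le (j + 1)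
    rw [abs_le] at hvalley
    obtain ⟨t, ht⟩ := Nat.exists_eq_add_of_le h
    obtain ⟨u, hu⟩ := Nat.exists_eq_add_of_le h₂
    have hρ₁ := subwordComplexity_add j t (by omega)
    have hρ₂ := subwordComplexity_add j (t + u) (by omega)
    rw [← ht] at hρ₁
    rw [← add_assoc, ← ht, ← hu] at hρ₂
    have hρ₃ : (subwordComplexity kimberlingWord ((branchWord (j + 1)).length + 1) : ℝ) =
        subwordComplexity kimberlingWord n + u := by
      exact_mod_cast (by omega)
    have hρ₁' : (subwordComplexity kimberlingWord n : ℝ) =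
        subwordComplexity kimberlingWord ((maximalWord j).length + 1) + t := by
      exact_mod_cast hρ₁
    have ht' : (n : ℝ) = ((maximalWord j).length + 1 : ℕ) + t := by exact_mod_cast ht
    have hu' : (((branchWord (j + 1)).length + 1 : ℕ) : ℝ) = n + u := by exact_mod_cast hu
    have ht₀ : (0 : ℝ) ≤ t := t.cast_nonneg
    have hu₀ : (0 : ℝ) ≤ u := u.cast_nonneg
    constructor
    · rw [hu', hρ₃] at hvalley
      nlinarith
    · rw [ht', hρ₁']
      nlinarith

/-! ### Passage to the upper and lower limits -/

theorem tendsto_coe_add_div (a c : ℝ) :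
    Tendsto (fun n : ℕ => ((a + c / n : ℝ) : EReal)) atTop (nhds (a : EReal)) := by
  refine (continuous_coe_real_ereal.tendsto _).comp ?_
  simpa using (tendsto_const_div_atTop_nhds_zero_nat c).const_add a

theorem tendsto_div_of_abs_sub_le {f x : ℕ → ℕ} {a c : ℝ} (hx : Tendsto x atTop atTop)
    (h : ∀ j, |(f (x j) : ℝ) - a * x j| ≤ c) :
    Tendsto (fun j => (((f (x j) : ℝ) / (x j : ℝ) : ℝ) : EReal)) atTop (nhds (a : EReal)) := by
  have hpos : ∀ᶠ j in atTop, 0 < x j := hx.eventually_gt_atTop 0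
  refine tendsto_of_tendsto_of_tendsto_of_le_of_le' ((tendsto_coe_add_div a (-c)).comp hx)
    ((tendsto_coe_add_div a c).comp hx) ?_ ?_
  all_goals
    filter_upwards [hpos] with j hj
    have hj' : (0 : ℝ) < x j := by exact_mod_cast hj
    have := abs_le.1 (h j)
    simp only [Function.comp_apply, EReal.coe_le_coe_iff]
  · rw [le_div_iff₀ hj', add_mul, div_mul_cancel₀ _ hj'.ne']
    linarith
  · rw [div_le_iff₀ hj', add_mul, div_mul_cancel₀ _ hj'.ne']
    linarith

/-- The linear bound gives ≤; along the subsequence x the ratio converges to a, which gives ≥. -/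
theorem limsup_div_eq {f x : ℕ → ℕ} {a c : ℝ} (hf : ∀ᶠ n in atTop, (f n : ℝ) ≤ a * n + c)
    (hx : Tendsto x atTop atTop) (h : ∀ j, |(f (x j) : ℝ) - a * x j| ≤ c) :
    limsup (fun n : ℕ => (((f n : ℝ) / (n : ℝ) : ℝ) : EReal)) atTop = (a : EReal) := by
  apply le_antisymm
  · rw [← (tendsto_coe_add_div a c).limsup_eq]
    refine limsup_le_limsup ?_
    filter_upwards [hf, eventually_gt_atTop 0] with n hn hpos
    have hpos' : (0 : ℝ) < n := by exact_mod_cast hpos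
    rw [EReal.coe_le_coe_iff, div_le_iff₀ hpos', add_mul, div_mul_cancel₀ _ hpos'.ne']
    exact hn
  · rw [← (tendsto_div_of_abs_sub_le hx h).limsup_eq]
    exact limsup_le_limsup_of_le hx (u := fun n : ℕ => (((f n : ℝ) / (n : ℝ) : ℝ) : EReal))

theorem liminf_div_eq {f x : ℕ → ℕ} {a c : ℝ} (hf : ∀ᶠ n in atTop, a * n - c ≤ (f n : ℝ))
    (hx : Tendsto x atTop atTop) (h : ∀ j, |(f (x j) : ℝ) - a * x j| ≤ c) :
    liminf (fun n : ℕ => (((f n : ℝ) / (n : ℝ) : ℝ) : EReal)) atTop = (a : EReal) := by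
  apply le_antisymm
  · rw [← (tendsto_div_of_abs_sub_le hx h).liminf_eq]
    exact liminf_le_liminf_of_le hx (u := fun n : ℕ => (((f n : ℝ) / (n : ℝ) : ℝ) : EReal))
  · rw [← (tendsto_coe_add_div a (-c)).liminf_eq]
    refine liminf_le_liminf ?_
    filter_upwards [hf, eventually_gt_atTop 0] with n hn hpos
    have hpos' : (0 : ℝ) < n := by exact_mod_cast hpos
    rw [EReal.coe_le_coe_iff, le_div_iff₀ hpos', add_mul, div_mul_cancel₀ _ hpos'.ne']
    linarith

end Kimberling

theorem corollary10 :
    limsup (fun n : ℕ =>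
        (((subwordComplexity kimberlingWord n : ℝ) / (n : ℝ) : ℝ) : EReal)) atTop
      = (((30 + Real.sqrt 3) / 23 : ℝ) : EReal) ∧
    liminf (fun n : ℕ =>
        (((subwordComplexity kimberlingWord n : ℝ) / (n : ℝ) : ℝ) : EReal)) atTop
      = (((3 + Real.sqrt 3) / 4 : ℝ) : EReal) := by
  constructor
  · refine Kimberling.limsup_div_eq ?_ Kimberling.tendsto_length_maximalWord
      Kimberling.abs_subwordComplexity_maximal_sub_le
    filter_upwards [eventually_ge_atTop 3] with n hn using (Kimberling.subwordComplexity_bounds hn).2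
  · refine Kimberling.liminf_div_eq ?_ Kimberling.tendsto_length_branchWord
      Kimberling.abs_subwordComplexity_branch_sub_le
    filter_upwards [eventually_ge_atTop 3] with n hn using (Kimberling.subwordComplexity_bounds hn).1
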